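/- Let \(n,q,\ell\) be nonnegative integers and let \(\mathbb{S}^n\) be the space of real symmetric \(n\times n\) matrices with the inner product \(\langle X,Y\rangle=\mathrm{Tr}(XY)\). An affine inverse eigenvalue problem is given by a spectrum \(\Lambda=\{(\lambda_i,m_i)\}_{i=1}^q\) of real numbers \(\lambda_i\) and nonnegative integers \(m_i\) with \(\sum_i m_i=n\), and by an affine space \(\mathcal{E}=\{X\in\mathbb{S}^n : \mathrm{Tr}(C_kX)=b_k,\ k=1,\dots,\ell\}\), where \(C_k\in\mathbb{S}^n\) and \(b_k\in\mathbb{R}\). Let \(\mathbb{R}[Z]\) be the ring of real polynomials in the entries of \(q\) symmetric \(n\times n\) matrices \(Z_1,\dots,Z_q\) of indeterminates (so \(q\binom{n+1}{2}\) variables), let \(\Sigma\subset\mathbb{R}[Z]\) be the set of sums of squares of polynomials, and put \[ f_1=\sum_{i=1}^q Z_i-I,\quad f_2^{(i)}=\mathrm{Tr}(Z_i)-m_i,\quad f_3^{(i)}=Z_i^2-Z_i,\quad f_4^{(k)}=\sum_{i=1}^q\lambda_i\mathrm{Tr}(Z_iC_k)-b_k . \] Let \(\mathcal{I}_2\subset\mathbb{R}[Z]\)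 be the set of all polynomials \[ \mathrm{Tr}(h_1f_1)+\sum_{i=1}^q\Big[h_2^{(i)}f_2^{(i)}+\mathrm{Tr}\big(h_3^{(i)}f_3^{(i)}\big)\Big]+\sum_{k=1}^{\ell}h_4^{(k)}f_4^{(k)}, \] where \(h_1\) is a symmetric \(n\times n\) matrix whose entries are polynomials of degree at most one, \(h_2^{(i)}\) and \(h_4^{(k)}\) are polynomials of degree at most one, and \(h_3^{(i)}\in\mathbb{S}^n\) is constant. For \(s,t\in\{1,\dots,n\}\) let \(f_{s,t}=e_se_t^T\) if \(s=t\) and \(f_{s,t}=\tfrac12(e_se_t^T+e_te_s^T)\) otherwise. Let \(\mathcal{R}_2(\Lambda,\mathcal{E})\) be the set of all \((Z_1,\dots,Z_q)\in(\mathbb{S}^n)^q\) for which there are linear maps \(\mathcal{W}_{i,j}:\mathbb{S}^n\to\mathbb{S}^n\) \((i,j=1,\dots,q)\) and a linear map \(\mathfrak{W}:(\mathbb{S}^n)^q\to(\mathbb{S}^n)^q\) such that \(\mathfrak{W}\) is positive semidefinite (that is, self-adjoint for the inner product \(\sum_i\mathrm{Tr}(X_iY_i)\), with nonnegative quadratic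 form), \([\mathfrak{W}(X_1,\dots,X_q)]_i=\sum_{j}\mathcal{W}_{i,j}(X_j)\) for all \(i\) and all \((X_1,\dots,X_q)\in(\mathbb{S}^n)^q\), and, for all \(i,j\in\{1,\dots,q\}\), \(k\in\{1,\dots,\ell\}\) and \(s,t\in\{1,\dots,n\}\), \[ Z_i\succeq0,\qquad \sum_{i=1}^q Z_i=I,\qquad \mathrm{Tr}(Z_i)=m_i,\qquad \sum_{i=1}^q\lambda_i\mathrm{Tr}(Z_iC_k)=b_k, \] \[ \sum_{j=1}^q\mathcal{W}_{i,j}(f_{s,t})=\delta_{s,t}Z_i,\qquad \sum_{s=1}^n\mathcal{W}_{i,j}(f_{s,s})=m_jZ_i, \] \[ \sum_{r=1}^n\mathrm{Tr}\big(f_{s,r}\,\mathcal{W}_{i,i}(f_{t,r})\big)=(Z_i)_{s,t},\qquad \sum_{j=1}^q\lambda_j\mathcal{W}_{i,j}(C_k)=b_kZ_i . \] Then exactly one of the following two statements is true: \[ (1)\ \ \mathcal{R}_2(\Lambda,\mathcal{E})\neq\emptyset,\qquad\qquad (2)\ \ -1\in\mathcal{I}_2+\Sigma . \] -/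

import Mathlib

open scoped Pointwise

/-- The space `𝕊ⁿ` of real symmetric `n × n` matrices, as a real vector space. -/
def SymMat (n : ℕ) : Submodule ℝ (Matrix (Fin n) (Fin n) ℝ) where
  carrier := {A | A.IsSymm}
  add_mem' := fun ha hb => Matrix.IsSymm.add ha hb
  zero_mem' := Matrix.isSymm_zero
  smul_mem' := fun c _ ha => Matrix.IsSymm.smul ha c

/-- The symmetric matrix unit `f_{s,t}`: it is `e_s e_sᵀ` if `s = t`, and
`(e_s e_tᵀ + e_t e_sᵀ) / 2` otherwise. -/
noncomputable def symUnit {n : ℕ} (s t : Fin n) : SymMat n :=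
  ⟨if s = t then Matrix.single s s 1
    else (1 / 2 : ℝ) • (Matrix.single s t 1 + Matrix.single t s 1), by
    change Matrix.IsSymm _
    split_ifs
    · simp [Matrix.IsSymm]
    · simp [Matrix.IsSymm, add_comm]⟩

/-- The trace inner product `∑ i, Tr (X_i Y_i)` on `q`-tuples of symmetric matrices. -/
noncomputable def traceInner {n q : ℕ} (X Y : Fin q → SymMat n) : ℝ :=
  ∑ i, ((X i : Matrix (Fin n) (Fin n) ℝ) * (Y i : Matrix (Fin n) (Fin n) ℝ)).trace

/-- A linear operator on `q`-tuples of symmetric matrices is positive semidefinite if it is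
self-adjoint for the trace inner product and its quadratic form is nonnegative. -/
def IsPSDOperator {n q : ℕ} (T : (Fin q → SymMat n) →ₗ[ℝ] (Fin q → SymMat n)) : Prop :=
  (∀ X Y, traceInner (T X) Y = traceInner X (T Y)) ∧ ∀ X, 0 ≤ traceInner X (T X)

/-- An instance of the affine inverse eigenvalue problem on `n × n` matrices: a spectrum given by
`q` eigenvalue-multiplicity pairs whose multiplicities sum to `n`, and the affine space
`{X ∈ 𝕊ⁿ | Tr (C_k X) = b_k, k = 1, …, ℓ}`. -/
structure AffineIEP (n q ℓ : ℕ) where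
  /-- the prescribed eigenvalues `λ_i` -/
  eig : Fin q → ℝ
  /-- their multiplicities `m_i` -/
  mult : Fin q → ℕ
  sum_mult : ∑ i, mult i = n
  /-- the symmetric matrices `C_k` of the linear equations -/
  coeff : Fin ℓ → SymMat n
  /-- the right-hand sides `b_k` -/
  rhs : Fin ℓ → ℝ

/-- Real polynomials in the entries of `q` symmetric `n × n` matrices: one variable for each index
`i` and each unordered pair `{s, t}`, hence `q * n * (n + 1) / 2` variables. -/
abbrev EntryPoly (n q : ℕ) : Type := MvPolynomial (Fin q × Sym2 (Fin n)) ℝ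

namespace AffineIEP

variable {n q ℓ : ℕ}

/-- The symmetric matrix `Z_i` of indeterminates. -/
noncomputable def Z (i : Fin q) : Matrix (Fin n) (Fin n) (EntryPoly n q) :=
  Matrix.of fun s t => MvPolynomial.X (i, s(s, t))

/-- A real matrix regarded as a matrix of constant polynomials. -/
noncomputable def constMat (A : Matrix (Fin n) (Fin n) ℝ) :
    Matrix (Fin n) (Fin n) (EntryPoly n q) :=
  A.map MvPolynomial.C

/-- `f_1 = ∑ i, Z_i - I`, a matrix of polynomials. -/
noncomputable def f1 (_P : AffineIEP n q ℓ) : Matrix (Fin n) (Fin n) (EntryPoly n q) :=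
  ∑ i, Z i - 1

/-- `f_2^{(i)} = Tr Z_i - m_i`. -/
noncomputable def f2 (P : AffineIEP n q ℓ) (i : Fin q) : EntryPoly n q :=
  (Z i : Matrix (Fin n) (Fin n) (EntryPoly n q)).trace - MvPolynomial.C (P.mult i : ℝ)

/-- `f_3^{(i)} = Z_i² - Z_i`, a matrix of polynomials. -/
noncomputable def f3 (_P : AffineIEP n q ℓ) (i : Fin q) :
    Matrix (Fin n) (Fin n) (EntryPoly n q) :=
  Z i ^ 2 - Z i

/-- `f_4^{(k)} = ∑ i, λ_i Tr (Z_i C_k) - b_k`. -/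
noncomputable def f4 (P : AffineIEP n q ℓ) (k : Fin ℓ) : EntryPoly n q :=
  ∑ i, MvPolynomial.C (P.eig i) * (Z i * constMat (P.coeff k : Matrix (Fin n) (Fin n) ℝ)).trace
    - MvPolynomial.C (P.rhs k)

/-- The truncated ideal `𝓘₂`: the coefficients `h_1` (a symmetric matrix of polynomials),
`h_2^{(i)}` and `h_4^{(k)}` are affine, the coefficients `h_3^{(i)}` are constant symmetric
matrices. -/
def I2 (P : AffineIEP n q ℓ) : Set (EntryPoly n q) :=
  {p | ∃ (h1 : Matrix (Fin n) (Fin n) (EntryPoly n q)) (h2 : Fin q → EntryPoly n q)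
      (h3 : Fin q → SymMat n) (h4 : Fin ℓ → EntryPoly n q),
    h1.IsSymm ∧ (∀ s t, (h1 s t).totalDegree ≤ 1) ∧
    (∀ i, (h2 i).totalDegree ≤ 1) ∧ (∀ k, (h4 k).totalDegree ≤ 1) ∧
    p = (h1 * P.f1).trace
      + ∑ i, (h2 i * P.f2 i
          + (constMat (h3 i : Matrix (Fin n) (Fin n) ℝ) * P.f3 i).trace)
      + ∑ k, P.f4 k * h4 k}

/-- The set `Σ` of sums of squares of polynomials. -/
def sumsOfSquares (n q : ℕ) : Set (EntryPoly n q) :=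
  {p | IsSumSq p}

/-- The semidefinite relaxation `𝓡₂(Λ, 𝓔)`. -/
def R2 (P : AffineIEP n q ℓ) : Set (Fin q → SymMat n) :=
  {Z | ∃ (W : Fin q → Fin q → (SymMat n →ₗ[ℝ] SymMat n))
      (𝔚 : (Fin q → SymMat n) →ₗ[ℝ] (Fin q → SymMat n)),
    IsPSDOperator 𝔚 ∧
    (∀ X i, 𝔚 X i = ∑ j, W i j (X j)) ∧
    (∀ i, (Z i : Matrix (Fin n) (Fin n) ℝ).PosSemidef) ∧
    (∑ i, (Z i : Matrix (Fin n) (Fin n) ℝ) = 1) ∧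
    (∀ i, (Z i : Matrix (Fin n) (Fin n) ℝ).trace = P.mult i) ∧
    (∀ k, ∑ i, P.eig i *
      ((Z i : Matrix (Fin n) (Fin n) ℝ) * (P.coeff k : Matrix (Fin n) (Fin n) ℝ)).trace
        = P.rhs k) ∧
    (∀ i s t, ∑ j, W i j (symUnit s t) = (if s = t then (1 : ℝ) else 0) • Z i) ∧
    (∀ i j, ∑ s, W i j (symUnit s s) = (P.mult j : ℝ) • Z i) ∧
    (∀ i s t, ∑ r, ((symUnit s r : Matrix (Fin n) (Fin n) ℝ) *
      (W i i (symUnit t r) : Matrix (Fin n) (Fin n) ℝ)).trace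
        = (Z i : Matrix (Fin n) (Fin n) ℝ) s t) ∧
    (∀ i k, ∑ j, P.eig j • W i j (P.coeff k) = P.rhs k • Z i)}

end AffineIEP

/-!
Both alternatives are about a linear functional `L` on polynomials with `L 1 = 1` that vanishes on
`I2` and is nonnegative on squares: a point of `R2` is the list of its moments of degree at most
two, with `L` applied entrywise: `Z_i = L (Z_i)` and
`Tr (X W_{i,j} (Y)) = L (Tr (Z_i X) Tr (Z_j Y))`.

A point of `R2` excludes a certificate `-1 = p + σ`. The constraints give `𝔚 (I, …, I) = n Z`, so
Cauchy–Schwarz for `𝔚` yields `Z Zᵀ ≤ 𝔚` (`IsPSDOperator.sq_traceInner_le`). Hence `Z` and `𝔚` are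
the mean and the second moments of a finitely supported probability measure
(`exists_functional_of_covariance_posSemidef`). Its integral `L` is nonnegative on sums of squares
of arbitrary degree, so the degree of `σ` need not be controlled, and the linear constraints of
`R2` say that `L` vanishes on `I2`. Applying `L` gives `-1 = L σ ≥ 0`.

Conversely, suppose `-1` is not in the cone `I2 + Σ`. The functional is produced by the Riesz
extension theorem (`exists_linear_functional_of_order_unit`); the closedness of the cone plays no
role because `1` is an order unit on the relevant subspace: `Tr Z_i² = Tr Z_i = m_i` modulo `I2`,
so every square of a linear form lies below a constant
(`AffineIEP.exists_smul_one_sub_sq_mem`). The moments of `L` then satisfy all the constraints of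
`R2`, where `Z_i ⪰ 0` follows from `L (Z_i) = L (Z_i²)`.
-/

/-! ### Functionals nonnegative on a cone, and functionals with given moments -/

theorem IsSumSq.smul_mvPolynomial {σ : Type*} {c : ℝ} (hc : 0 ≤ c)
    {p : MvPolynomial σ ℝ} (hp : IsSumSq p) : IsSumSq (c • p) := by
  have : IsSumSq (MvPolynomial.C (σ := σ) c) := by
    rw [← Real.mul_self_sqrt hc, map_mul]
    exact .mul_self _
  rw [MvPolynomial.smul_eq_C_mul]
  exact this.mul hp

/-- Separation without topology: if `-e` lies outside a convex cone containing `e`, some linear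
functional is `1` at `e` and nonnegative on the elements of the cone that lie below a multiple of
`e`. It comes from the Riesz extension theorem on the subspace of elements bounded on both sides by
multiples of `e`, where `e` is an order unit, and is then extended arbitrarily. -/
theorem exists_linear_functional_of_order_unit {A : Type*} [AddCommGroup A] [Module ℝ A]
    (K : PointedCone ℝ A) (e : A) (he : e ∈ K) (hne : -e ∉ K) :
    ∃ L : A →ₗ[ℝ] ℝ, L e = 1 ∧ ∀ p ∈ K, (∃ N : ℝ, N • e - p ∈ K) → 0 ≤ L p := by
  have smulK : ∀ {c : ℝ} {x : A}, 0 ≤ c → x ∈ K → c • x ∈ K := fun hc hx =>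
    K.smul_mem hc hx
  -- the subspace of order-bounded elements, on which the cone has the order unit `e`
  let B : Submodule ℝ A :=
    { carrier := {p | ∃ N : ℝ, N • e + p ∈ K ∧ N • e - p ∈ K}
      zero_mem' := ⟨0, by simp, by simp⟩
      add_mem' := by
        rintro p r ⟨N, h1, h2⟩ ⟨M, h3, h4⟩
        refine ⟨N + M, ?_, ?_⟩
        · convert K.add_mem h1 h3 using 1; module
        · convert K.add_mem h2 h4 using 1; module
      smul_mem' := by
        rintro c p ⟨N, h1, h2⟩
        rcases le_total 0 c with hc | hc
        · refine ⟨c * N, ?_, ?_⟩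
          · convert smulK hc h1 using 1; module
          · convert smulK hc h2 using 1; module
        · refine ⟨-c * N, ?_, ?_⟩
          · convert smulK (neg_nonneg.2 hc) h2 using 1; module
          · convert smulK (neg_nonneg.2 hc) h1 using 1; module }
  have heB : e ∈ B := ⟨1, by simpa using K.add_mem he he, by simp⟩
  have he0 : (⟨e, heB⟩ : B) ≠ 0 := by
    intro h
    have h0 : e = 0 := congrArg Subtype.val h
    exact hne (by simp [h0])
  obtain ⟨g, hg1, hg2⟩ := riesz_extension (K.comap B.subtype)
    (LinearPMap.mkSpanSingleton (⟨e, heB⟩ : B) (1 : ℝ) he0) (by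
      rintro ⟨x, hx⟩ hxK
      obtain ⟨c, rfl⟩ := Submodule.mem_span_singleton.1 hx
      have hcK : c • e ∈ K := hxK
      by_contra! hc
      have hc' : c < 0 := by
        erw [LinearPMap.mkSpanSingleton'_apply] at hc
        simpa using hc
      refine hne ?_
      convert smulK (inv_nonneg.2 (neg_nonneg.2 hc'.le)) hcK using 1
      rw [smul_smul, inv_neg, neg_mul, inv_mul_cancel₀ hc'.ne, neg_one_smul]) (by
      rintro ⟨y, N, hN, -⟩
      exact ⟨⟨N • (⟨e, heB⟩ : B), Submodule.mem_span_singleton.2 ⟨N, rfl⟩⟩, hN⟩)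
  obtain ⟨L, hL⟩ := LinearMap.exists_extend g
  have hLg : ∀ (p : A) (hp : p ∈ B), L p = g ⟨p, hp⟩ := fun p hp => by rw [← hL]; rfl
  refine ⟨L, ?_, ?_⟩
  · rw [hLg e heB, hg1 ⟨⟨e, heB⟩, Submodule.mem_span_singleton_self _⟩]
    exact LinearPMap.mkSpanSingleton_apply _ _ he0 _
  · rintro p hp ⟨N, hN⟩
    have hpB : p ∈ B := by
      refine ⟨|N|, K.add_mem (smulK (abs_nonneg N) he) hp, ?_⟩
      have := K.add_mem hN (smulK (sub_nonneg.2 (le_abs_self N)) he)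
      convert this using 1
      module
    rw [hLg p hpB]
    exact hg2 _ hp

theorem MvPolynomial.mem_span_of_totalDegree_le_one {σ : Type*} {p : MvPolynomial σ ℝ}
    (hp : p.totalDegree ≤ 1) :
    p ∈ Submodule.span ℝ (insert 1 (Set.range (MvPolynomial.X : σ → MvPolynomial σ ℝ))) := by
  rw [p.as_sum]
  refine Submodule.sum_mem _ fun d hd => ?_
  have hd1 : (d.sum fun _ k => k) ≤ 1 := (MvPolynomial.le_totalDegree hd).trans hp
  have hmon : ∀ c : ℝ, MvPolynomial.monomial d c = c • MvPolynomial.monomial d (1 : ℝ) := by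
    intro c
    rw [MvPolynomial.smul_monomial, smul_eq_mul, mul_one]
  rw [hmon]
  refine Submodule.smul_mem _ _ (Submodule.subset_span ?_)
  rcases Nat.le_one_iff_eq_zero_or_eq_one.1 hd1 with h | h
  · left
    have : d = 0 := by
      ext a
      by_contra ha
      exact ha (by simpa using (Finset.sum_eq_zero_iff.1 h) a (by simpa using ha))
    rw [this]; rfl
  · right
    obtain ⟨a, rfl⟩ := (Finsupp.sum_eq_one_iff d).1 h
    exact ⟨a, rfl⟩

open MvPolynomial in
/-- First and second moments with a positive semidefinite covariance matrix are those of a finitely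
supported probability measure. Integration against that measure extends them to all polynomials and
is nonnegative on every sum of squares, whatever its degree. -/
theorem exists_functional_of_covariance_posSemidef {ι : Type*} [Fintype ι] [DecidableEq ι]
    (z : ι → ℝ) (M : Matrix ι ι ℝ) (hM : (M - Matrix.vecMulVec z z).PosSemidef) :
    ∃ L : MvPolynomial ι ℝ →ₗ[ℝ] ℝ, L 1 = 1 ∧ (∀ a, L (X a) = z a) ∧
      (∀ a b, L (X a * X b) = M a b) ∧ ∀ p, IsSumSq p → 0 ≤ L p := by
  obtain ⟨m, B, hB⟩ := Matrix.posSemidef_iff_eq_sum_vecMulVec.1 hM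
  -- If the covariance is `∑ k, B k (B k)ᵀ` with `m` summands, put mass `1 / (m + 1)` at the mean
  -- and `1 / (2 (m + 1))` at each point `z ± √(m + 1) • B k`; the extra mass at `z` covers `m = 0`.
  set N : ℝ := m + 1 with hN
  have hN0 : 0 < N := by positivity
  have hsq : √N * √N = N := Real.mul_self_sqrt hN0.le
  let E : (ι → ℝ) → MvPolynomial ι ℝ →ₗ[ℝ] ℝ := fun x => (aeval x).toLinearMap
  refine ⟨(1 / (2 * N)) • ((2 : ℝ) • E z + ∑ k, (E (z + √N • B k) + E (z - √N • B k))),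
    ?_, ?_, ?_, ?_⟩
  · simp [E, Finset.sum_add_distrib]
    field_simp
    rw [hN]; ring
  · intro a
    simp [E, ← two_mul]
    field_simp
    rw [hN]; ring
  · intro a b
    have hab : M a b = z a * z b + ∑ k, B k a * B k b := by
      have := congrFun (congrFun hB a) b
      simp only [Matrix.sub_apply, Matrix.vecMulVec_apply, Matrix.sum_apply, star_trivial] at this
      linarith
    have hk : ∀ k, (z a + √N * B k a) * (z b + √N * B k b) +
        (z a - √N * B k a) * (z b - √N * B k b) = 2 * (z a * z b) + 2 * N * (B k a * B k b) := by
      intro k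
      linear_combination 2 * (B k a * B k b) * hsq
    have hsum : ∑ k, ((z a + √N * B k a) * (z b + √N * B k b) +
        (z a - √N * B k a) * (z b - √N * B k b)) =
        m * (2 * (z a * z b)) + 2 * N * ∑ k, B k a * B k b := by
      simp only [hk, Finset.sum_add_distrib, ← Finset.mul_sum]
      simp
      ring
    simp [E, hsum, hab]
    field_simp
    rw [hN]; ring
  · intro p hp
    have hE : ∀ x, 0 ≤ E x p := by
      intro x
      induction hp with
      | zero => simp
      | sq_add a _ ih =>
        rw [map_add]
        refine add_nonneg ?_ ih
        change 0 ≤ aeval x (a * a)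
        rw [map_mul]
        exact mul_self_nonneg _
    simp only [LinearMap.smul_apply, LinearMap.add_apply, LinearMap.sum_apply, smul_eq_mul]
    exact mul_nonneg (by positivity) (add_nonneg (mul_nonneg zero_le_two (hE _))
      (Finset.sum_nonneg fun k _ => add_nonneg (hE _) (hE _)))

/-! ### Symmetric matrix units and linear forms -/

/-- Pairing with `f_{s,t}` reads off an entry; stated over an algebra so that it applies both to
real matrices and to matrices of polynomials. -/
theorem trace_symUnit_map_mul {n : ℕ} {R : Type*} [CommRing R] [Algebra ℝ R] (s t : Fin n)
    {A : Matrix (Fin n) (Fin n) R} (hA : A.IsSymm) :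
    ((symUnit s t : Matrix (Fin n) (Fin n) ℝ).map (algebraMap ℝ R) * A).trace = A s t := by
  have hsingle : ∀ (u v : Fin n) (c : ℝ),
      ((Matrix.single u v c).map (algebraMap ℝ R) * A).trace = algebraMap ℝ R c * A v u := by
    intro u v c
    rw [Matrix.map_single, Matrix.trace_single_mul, smul_eq_mul]
  by_cases h : s = t
  · subst h
    simp only [symUnit, if_true, hsingle, map_one, one_mul]
  · have hst : (symUnit s t : Matrix (Fin n) (Fin n) ℝ) =
        Matrix.single s t (1 / 2) + Matrix.single t s (1 / 2) := by
      simp [symUnit, h, smul_add, Matrix.smul_single]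
    rw [hst, Matrix.map_add _ (map_add _), add_mul, Matrix.trace_add, hsingle, hsingle,
      hA.apply s t, ← add_mul, ← map_add]
    norm_num

theorem trace_symUnit_mul {n : ℕ} (s t : Fin n) (A : SymMat n) :
    ((symUnit s t : Matrix (Fin n) (Fin n) ℝ) * (A : Matrix (Fin n) (Fin n) ℝ)).trace =
      (A : Matrix (Fin n) (Fin n) ℝ) s t := by
  simpa using trace_symUnit_map_mul (R := ℝ) s t A.2

theorem symUnit_comm {n : ℕ} (s t : Fin n) : symUnit s t = symUnit t s := by
  apply Subtype.ext
  by_cases h : s = t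
  · rw [h]
  · simp [symUnit, h, Ne.symm h, add_comm]

theorem SymMat.eq_sum_symUnit {n : ℕ} (A : SymMat n) :
    A = ∑ s, ∑ t, (A : Matrix (Fin n) (Fin n) ℝ) s t • symUnit s t := by
  apply Subtype.ext
  ext u v
  rw [← trace_symUnit_mul, ← trace_symUnit_mul, Matrix.trace_mul_comm,
    Matrix.trace_mul_comm (symUnit u v).1]
  have key : ∀ s t : Fin n, (A : Matrix (Fin n) (Fin n) ℝ) s t *
      ((symUnit s t : Matrix (Fin n) (Fin n) ℝ) * (symUnit u v : Matrix (Fin n) (Fin n) ℝ)).trace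
      = (A : Matrix (Fin n) (Fin n) ℝ) s t * (symUnit u v : Matrix (Fin n) (Fin n) ℝ) t s := by
    intro s t
    rw [trace_symUnit_mul, (symUnit u v).2.apply]
  simp only [Submodule.coe_sum, Submodule.coe_smul, Finset.sum_mul, Matrix.trace_sum,
    Matrix.smul_mul, Matrix.trace_smul, smul_eq_mul, key]
  simp only [Matrix.trace, Matrix.diag_apply, Matrix.mul_apply]

theorem sum_symUnit_self {n : ℕ} :
    ((∑ s, symUnit s s : SymMat n) : Matrix (Fin n) (Fin n) ℝ) = 1 := by
  rw [Submodule.coe_sum]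
  simp only [symUnit, if_true]
  ext u v
  simp [Matrix.sum_apply, Matrix.single_apply, Matrix.one_apply, ite_and]

/-- The linear form `Tr (Z_i Y)` in the entries of `Z_i`. -/
noncomputable def traceVar {n q : ℕ} (i : Fin q) : SymMat n →ₗ[ℝ] EntryPoly n q where
  toFun Y := ∑ s, ∑ t, (Y : Matrix (Fin n) (Fin n) ℝ) s t • MvPolynomial.X (i, s(s, t))
  map_add' A B := by simp [add_smul, Finset.sum_add_distrib]
  map_smul' c A := by simp [mul_smul, Finset.smul_sum]

theorem traceVar_apply {n q : ℕ} (i : Fin q) (Y : SymMat n) :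
    (traceVar i Y : EntryPoly n q) =
      ∑ s, ∑ t, (Y : Matrix (Fin n) (Fin n) ℝ) s t • MvPolynomial.X (i, s(s, t)) := rfl

/-! ### The relations and the truncated ideal -/

namespace AffineIEP

variable {n q ℓ : ℕ}

theorem Z_isSymm (i : Fin q) : (Z i : Matrix (Fin n) (Fin n) (EntryPoly n q)).IsSymm := by
  ext s t
  simp [Z, Sym2.eq_swap]

theorem traceVar_eq_trace (i : Fin q) (Y : SymMat n) :
    traceVar i Y = (Z i * constMat (Y : Matrix (Fin n) (Fin n) ℝ)).trace := by
  simp only [traceVar_apply, Matrix.trace, Matrix.diag_apply, Matrix.mul_apply, Z, constMat,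
    Matrix.of_apply, Matrix.map_apply]
  refine Finset.sum_congr rfl fun s _ => Finset.sum_congr rfl fun t _ => ?_
  rw [MvPolynomial.smul_eq_C_mul, mul_comm, Y.2.apply]

theorem traceVar_symUnit (i : Fin q) (s t : Fin n) :
    (traceVar i (symUnit s t) : EntryPoly n q) = MvPolynomial.X (i, s(s, t)) := by
  rw [traceVar_eq_trace, Matrix.trace_mul_comm]
  exact trace_symUnit_map_mul s t (Z_isSymm i)

theorem f1_apply (P : AffineIEP n q ℓ) (s t : Fin n) :
    P.f1 s t = ∑ i, MvPolynomial.X (i, s(s, t)) - (if s = t then 1 else 0) := by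
  simp [f1, Z, Matrix.sum_apply, Matrix.one_apply]

theorem f1_isSymm (P : AffineIEP n q ℓ) : P.f1.IsSymm := by
  ext s t
  simp only [Matrix.transpose_apply, f1_apply, Sym2.eq_swap, eq_comm]

theorem f2_eq (P : AffineIEP n q ℓ) (i : Fin q) :
    P.f2 i = ∑ s, MvPolynomial.X (i, s(s, s)) - MvPolynomial.C (P.mult i : ℝ) := rfl

theorem f3_apply (P : AffineIEP n q ℓ) (i : Fin q) (s t : Fin n) :
    P.f3 i s t = ∑ r, MvPolynomial.X (i, s(s, r)) * MvPolynomial.X (i, s(t, r)) -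
      MvPolynomial.X (i, s(s, t)) := by
  simp only [f3, sq, Matrix.sub_apply, Matrix.mul_apply, Z, Matrix.of_apply]
  congr 1
  exact Finset.sum_congr rfl fun r _ => by rw [Sym2.eq_swap (a := r)]

theorem f3_isSymm (P : AffineIEP n q ℓ) (i : Fin q) : (P.f3 i).IsSymm := by
  have h := Z_isSymm (n := n) i
  exact (h.pow 2).sub h

theorem f4_eq (P : AffineIEP n q ℓ) (k : Fin ℓ) :
    P.f4 k = ∑ i, P.eig i • traceVar i (P.coeff k) - MvPolynomial.C (P.rhs k) := by
  simp only [f4, traceVar_eq_trace, MvPolynomial.smul_eq_C_mul]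

/-- `I2` as a linear subspace of the polynomial ring. -/
def I2Submodule (P : AffineIEP n q ℓ) : Submodule ℝ (EntryPoly n q) where
  carrier := P.I2
  zero_mem' := ⟨0, 0, 0, 0, Matrix.isSymm_zero, by simp, by simp, by simp, by
    simp [constMat]⟩
  add_mem' := by
    rintro _ _ ⟨h1, h2, h3, h4, s1, d1, d2, d4, rfl⟩ ⟨g1, g2, g3, g4, s1', d1', d2', d4', rfl⟩
    refine ⟨h1 + g1, h2 + g2, h3 + g3, h4 + g4, s1.add s1', ?_, ?_, ?_, ?_⟩
    · exact fun s t => (MvPolynomial.totalDegree_add _ _).trans (max_le (d1 s t) (d1' s t))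
    · exact fun i => (MvPolynomial.totalDegree_add _ _).trans (max_le (d2 i) (d2' i))
    · exact fun k => (MvPolynomial.totalDegree_add _ _).trans (max_le (d4 k) (d4' k))
    · have hc : ∀ A B : Matrix (Fin n) (Fin n) ℝ,
          (constMat (A + B) : Matrix (Fin n) (Fin n) (EntryPoly n q)) =
            constMat A + constMat B := fun A B => Matrix.map_add _ (map_add _) A B
      simp only [Pi.add_apply, Submodule.coe_add, hc, add_mul, mul_add, Matrix.trace_add,
        Finset.sum_add_distrib]
      abel
  smul_mem' := by
    rintro c _ ⟨h1, h2, h3, h4, s1, d1, d2, d4, rfl⟩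
    refine ⟨c • h1, c • h2, c • h3, c • h4, s1.smul c, ?_, ?_, ?_, ?_⟩
    · exact fun s t => (MvPolynomial.totalDegree_smul_le _ _).trans (d1 s t)
    · exact fun i => (MvPolynomial.totalDegree_smul_le _ _).trans (d2 i)
    · exact fun k => (MvPolynomial.totalDegree_smul_le _ _).trans (d4 k)
    · have hc : ∀ A : Matrix (Fin n) (Fin n) ℝ,
          (constMat (c • A) : Matrix (Fin n) (Fin n) (EntryPoly n q)) = c • constMat A := by
        intro A
        ext1 s t
        simp [constMat, MvPolynomial.smul_eq_C_mul]
      simp only [Pi.smul_apply, Submodule.coe_smul, hc, smul_mul_assoc, mul_smul_comm,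
        Matrix.trace_smul, smul_add, Finset.smul_sum]

theorem mul_f1_mem (P : AffineIEP n q ℓ) {h : EntryPoly n q} (hh : h.totalDegree ≤ 1)
    (s t : Fin n) : h * P.f1 s t ∈ P.I2Submodule := by
  refine ⟨h • constMat (symUnit s t : Matrix (Fin n) (Fin n) ℝ), 0, 0, 0, ?_, ?_, by simp,
    by simp, ?_⟩
  · refine Matrix.IsSymm.smul ?_ h
    exact (symUnit s t).2.map _
  · intro u v
    rw [Matrix.smul_apply, smul_eq_mul, constMat, Matrix.map_apply]
    refine (MvPolynomial.totalDegree_mul _ _).trans ?_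
    simpa using hh
  · rw [smul_mul_assoc, Matrix.trace_smul, constMat, ← MvPolynomial.algebraMap_eq,
      trace_symUnit_map_mul s t P.f1_isSymm]
    simp [constMat]

theorem mul_f2_mem (P : AffineIEP n q ℓ) {h : EntryPoly n q} (hh : h.totalDegree ≤ 1)
    (i : Fin q) : h * P.f2 i ∈ P.I2Submodule := by
  refine ⟨0, Pi.single i h, 0, 0, Matrix.isSymm_zero, by simp, ?_, by simp, ?_⟩
  · intro j
    by_cases hj : j = i
    · subst hj; simpa using hh
    · simp [hj]
  · rw [Finset.sum_eq_single i]
    · simp [constMat]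
    · intro j _ hj
      simp [constMat, hj]
    · simp

theorem f3_mem (P : AffineIEP n q ℓ) (i : Fin q) (s t : Fin n) :
    P.f3 i s t ∈ P.I2Submodule := by
  refine ⟨0, 0, Pi.single i (symUnit s t), 0, Matrix.isSymm_zero, by simp, by simp, by simp, ?_⟩
  rw [Finset.sum_eq_single i]
  · rw [Pi.single_eq_same, constMat, ← MvPolynomial.algebraMap_eq,
      trace_symUnit_map_mul s t (P.f3_isSymm i)]
    simp
  · intro j _ hj
    simp [constMat, hj]
  · simp

theorem mul_f4_mem (P : AffineIEP n q ℓ) {h : EntryPoly n q} (hh : h.totalDegree ≤ 1)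
    (k : Fin ℓ) : h * P.f4 k ∈ P.I2Submodule := by
  refine ⟨0, 0, 0, Pi.single k h, Matrix.isSymm_zero, by simp, by simp, ?_, ?_⟩
  · intro j
    by_cases hj : j = k
    · subst hj; simpa using hh
    · simp [hj]
  · rw [Finset.sum_eq_single (f := fun j => P.f4 j * _) k]
    · simp [constMat, mul_comm]
    · intro j _ hj
      simp [hj]
    · simp

/-- A functional vanishing on the relations `f`, and on their products with the variables where
affine multipliers are allowed, vanishes on `I2`. -/
theorem map_eq_zero_of_mem_I2 (P : AffineIEP n q ℓ) (L : EntryPoly n q →ₗ[ℝ] ℝ)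
    (hf1 : ∀ s t, L (P.f1 s t) = 0)
    (hXf1 : ∀ a s t, L (MvPolynomial.X a * P.f1 s t) = 0)
    (hf2 : ∀ i, L (P.f2 i) = 0) (hXf2 : ∀ a i, L (MvPolynomial.X a * P.f2 i) = 0)
    (hf3 : ∀ i s t, L (P.f3 i s t) = 0)
    (hf4 : ∀ k, L (P.f4 k) = 0) (hXf4 : ∀ a k, L (MvPolynomial.X a * P.f4 k) = 0)
    {p : EntryPoly n q} (hp : p ∈ P.I2) : L p = 0 := by
  have affine : ∀ f : EntryPoly n q, L f = 0 → (∀ a, L (MvPolynomial.X a * f) = 0) →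
      ∀ h : EntryPoly n q, h.totalDegree ≤ 1 → L (h * f) = 0 := by
    intro f hf hXf h hh
    have := MvPolynomial.mem_span_of_totalDegree_le_one hh
    clear hh
    induction this using Submodule.span_induction with
    | mem x hx =>
      rcases hx with rfl | ⟨a, rfl⟩
      · simpa using hf
      · exact hXf a
    | zero => simp
    | add x y _ _ hx hy => rw [add_mul, map_add, hx, hy, add_zero]
    | smul c x _ hx => rw [smul_mul_assoc, map_smul, hx, smul_zero]
  obtain ⟨h1, h2, h3, h4, -, d1, d2, d4, rfl⟩ := hp
  simp only [Matrix.trace, Matrix.diag_apply, Matrix.mul_apply, map_add, map_sum]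
  have e1 : ∀ s t, L (h1 s t * P.f1 t s) = 0 := fun s t =>
    affine _ (hf1 t s) (fun a => hXf1 a t s) _ (d1 s t)
  have e2 : ∀ i, L (h2 i * P.f2 i) = 0 := fun i => affine _ (hf2 i) (fun a => hXf2 a i) _ (d2 i)
  have e3 : ∀ i s t, L (constMat (h3 i : Matrix (Fin n) (Fin n) ℝ) s t * P.f3 i t s) = 0 := by
    intro i s t
    rw [constMat, Matrix.map_apply, ← MvPolynomial.smul_eq_C_mul, map_smul, hf3, smul_zero]
  have e4 : ∀ k, L (P.f4 k * h4 k) = 0 := fun k => by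
    rw [mul_comm]; exact affine _ (hf4 k) (fun a => hXf4 a k) _ (d4 k)
  simp [e1, e2, e3, e4]

end AffineIEP

/-! ### A point of the relaxation excludes a certificate -/

/-- `traceInner` as a bilinear form. -/
noncomputable def traceForm (n q : ℕ) :
    (Fin q → SymMat n) →ₗ[ℝ] (Fin q → SymMat n) →ₗ[ℝ] ℝ :=
  LinearMap.mk₂ ℝ traceInner
    (fun X X' Y => by simp [traceInner, add_mul, Finset.sum_add_distrib])
    (fun c X Y => by simp [traceInner, Finset.mul_sum])
    (fun X Y Y' => by simp [traceInner, mul_add, Finset.sum_add_distrib])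
    (fun c X Y => by simp [traceInner, Finset.mul_sum])

theorem traceForm_apply {n q : ℕ} (X Y : Fin q → SymMat n) :
    traceForm n q X Y = traceInner X Y := rfl

theorem traceInner_comm {n q : ℕ} (X Y : Fin q → SymMat n) :
    traceInner X Y = traceInner Y X := by
  exact Finset.sum_congr rfl fun i _ => Matrix.trace_mul_comm _ _

theorem traceInner_single {n q : ℕ} (i : Fin q) (A : SymMat n) (Y : Fin q → SymMat n) :
    traceInner (Pi.single i A) Y =
      ((A : Matrix (Fin n) (Fin n) ℝ) * (Y i : Matrix (Fin n) (Fin n) ℝ)).trace := by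
  rw [traceInner, Finset.sum_eq_single i]
  · simp
  · intro j _ hj
    simp [hj]
  · simp

/-- If a positive semidefinite `T` maps `e` to `n • Z` with `⟨e, Z⟩ = n`, then `Z Zᵀ ≤ T`: this is
the Cauchy–Schwarz inequality `⟨X, T e⟩² ≤ ⟨X, T X⟩ ⟨e, T e⟩`. -/
theorem IsPSDOperator.sq_traceInner_le {n q : ℕ} (hn : 0 < n)
    {T : (Fin q → SymMat n) →ₗ[ℝ] (Fin q → SymMat n)} (hT : IsPSDOperator T)
    {e Z : Fin q → SymMat n} (hTe : T e = (n : ℝ) • Z) (heZ : traceInner e Z = n)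
    (X : Fin q → SymMat n) : traceInner X Z ^ 2 ≤ traceInner X (T X) := by
  have hn' : (n : ℝ) ≠ 0 := by positivity
  -- the minimizer over `c` of the quadratic form of `T` at `X - c • e`
  set c : ℝ := traceInner X Z / n with hc
  have h := hT.2 (X - c • e)
  have h1 : traceInner e (T X) = n * traceInner X Z := by
    rw [← hT.1, hTe, ← traceForm_apply, map_smul, LinearMap.smul_apply, traceForm_apply,
      traceInner_comm, smul_eq_mul]
  simp only [← traceForm_apply] at h h1 heZ hc ⊢
  simp only [map_sub, map_smul, hTe, LinearMap.sub_apply, LinearMap.smul_apply, h1, heZ,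
    smul_eq_mul] at h
  have hcn : c * n = traceForm n q X Z := by rw [hc]; field_simp
  nlinarith

namespace AffineIEP

variable {n q ℓ : ℕ}

/-- The symmetric matrix unit attached to an unordered pair of indices. -/
noncomputable def symUnitSym2 : Sym2 (Fin n) → SymMat n :=
  Sym2.lift ⟨symUnit, symUnit_comm⟩

/-- The tuple whose trace pairing with `X` is the entry of `X` that belongs to a variable. -/
noncomputable def entryTuple (a : Fin q × Sym2 (Fin n)) : Fin q → SymMat n :=
  Pi.single a.1 (symUnitSym2 a.2)

/-- A tuple `Z` and an operator `T ≥ Z Zᵀ` are the first and second moments of a functional that is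
nonnegative on all sums of squares. -/
theorem exists_moment_functional {Z : Fin q → SymMat n}
    {T : (Fin q → SymMat n) →ₗ[ℝ] (Fin q → SymMat n)} (hT : IsPSDOperator T)
    (hle : ∀ X, traceInner X Z ^ 2 ≤ traceInner X (T X)) :
    ∃ L : EntryPoly n q →ₗ[ℝ] ℝ, L 1 = 1 ∧
      (∀ i Y, L (traceVar i Y) = traceInner (Pi.single i Y) Z) ∧
      (∀ i j X Y, L (traceVar i X * traceVar j Y) =
        traceInner (Pi.single i X) (T (Pi.single j Y))) ∧
      ∀ p, IsSumSq p → 0 ≤ L p := by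
  obtain ⟨L, hL1, hLX, hLXX, hLsq⟩ := exists_functional_of_covariance_posSemidef
    (fun a => traceInner (entryTuple a) Z)
    (Matrix.of fun a b => traceInner (entryTuple a) (T (entryTuple b))) (by
      refine Matrix.PosSemidef.of_dotProduct_mulVec_nonneg ?_ fun x => ?_
      · ext a b
        simp only [Matrix.conjTranspose_apply, Matrix.sub_apply, Matrix.of_apply,
          Matrix.vecMulVec_apply, star_trivial]
        rw [← hT.1, traceInner_comm, mul_comm]
      · have h := hle (∑ a, x a • entryTuple a)
        rw [← sub_nonneg] at h
        refine h.trans_eq ?_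
        simp only [← traceForm_apply, map_sum, map_smul, LinearMap.sum_apply,
          LinearMap.smul_apply, dotProduct, Matrix.mulVec, Matrix.sub_apply, Matrix.of_apply,
          Matrix.vecMulVec_apply, star_trivial, smul_eq_mul, sub_mul, Finset.sum_sub_distrib,
          mul_sub, sq, Finset.mul_sum]
        congr 1
        · rw [Finset.sum_comm]
          refine Finset.sum_congr rfl fun a _ => Finset.sum_congr rfl fun b _ => ?_
          ring
        · refine Finset.sum_congr rfl fun a _ => ?_
          rw [Finset.sum_mul]
          refine Finset.sum_congr rfl fun b _ => ?_
          ring)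
  have hsingle : ∀ (i : Fin q) (Y : SymMat n), (Pi.single i Y : Fin q → SymMat n) =
      ∑ s, ∑ t, (Y : Matrix (Fin n) (Fin n) ℝ) s t • entryTuple (i, s(s, t)) := by
    intro i Y
    have : (Pi.single i Y : Fin q → SymMat n) = LinearMap.single ℝ (fun _ => SymMat n) i Y := rfl
    rw [this]
    conv_lhs => rw [SymMat.eq_sum_symUnit Y]
    simp only [map_sum, map_smul]
    rfl
  refine ⟨L, hL1, fun i Y => ?_, fun i j X Y => ?_, hLsq⟩
  · rw [hsingle, traceVar_apply]
    simp only [← traceForm_apply, map_sum, map_smul, LinearMap.sum_apply, LinearMap.smul_apply,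
      hLX]
  · rw [hsingle i, hsingle j, traceVar_apply, traceVar_apply]
    simp only [← traceForm_apply, map_sum, map_smul, LinearMap.sum_apply, LinearMap.smul_apply,
      Finset.sum_mul, Finset.mul_sum, smul_mul_assoc, mul_smul_comm, hLXX, Matrix.of_apply,
      Finset.smul_sum]

theorem neg_one_notMem_of_R2_nonempty (P : AffineIEP n q ℓ) (h : P.R2.Nonempty) :
    (-1 : EntryPoly n q) ∉ P.I2 + sumsOfSquares n q := by
  obtain ⟨Z, W, T, hT, hTW, -, hsum, htr, hlin, hW1, hW2, hW3, hW4⟩ := h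
  have hle : ∀ X, traceInner X Z ^ 2 ≤ traceInner X (T X) := by
    intro X
    rcases Nat.eq_zero_or_pos n with rfl | hn
    · have h0 : ∀ Y, traceInner X Y = 0 := fun Y => by simp [traceInner, Matrix.trace]
      simp [h0]
    · -- the tuple `e = (I, …, I)` satisfies `T e = n • Z`, since `∑ j, W i j I = ∑ s, Z i`
      refine hT.sq_traceInner_le hn (e := fun _ => ∑ s, symUnit s s) ?_ ?_ X
      · ext1 i
        rw [hTW]
        simp only [map_sum]
        rw [Finset.sum_comm]
        simp [hW1, Nat.cast_smul_eq_nsmul]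
      · simp only [traceInner, sum_symUnit_self, one_mul, htr]
        exact_mod_cast P.sum_mult
  obtain ⟨L, hL1, hLZ, hLW, hLsq⟩ := exists_moment_functional hT hle
  have hTsingle : ∀ i j Y, T (Pi.single j Y) i = W i j Y := by
    intro i j Y
    rw [hTW, Finset.sum_eq_single j]
    · simp
    · intro k _ hk
      simp [hk]
    · simp
  simp only [traceInner_single, hTsingle] at hLZ hLW
  have hLX : ∀ i s t, L (MvPolynomial.X (i, s(s, t))) = (Z i : Matrix (Fin n) (Fin n) ℝ) s t := by
    intro i s t
    rw [← traceVar_symUnit, hLZ, trace_symUnit_mul]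
  have hLC : ∀ c, L (MvPolynomial.C c) = c := fun c => by
    rw [← mul_one (MvPolynomial.C c), ← MvPolynomial.smul_eq_C_mul, map_smul, hL1, smul_eq_mul,
      mul_one]
  have hLXY : ∀ i j s t Y, L (MvPolynomial.X (i, s(s, t)) * traceVar j Y) =
      (W i j Y : Matrix (Fin n) (Fin n) ℝ) s t := by
    intro i j s t Y
    rw [← traceVar_symUnit, hLW, trace_symUnit_mul]
  have hLXC : ∀ i s t c, L (MvPolynomial.X (i, s(s, t)) * MvPolynomial.C c) =
      c * (Z i : Matrix (Fin n) (Fin n) ℝ) s t := by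
    intro i s t c
    rw [mul_comm, ← MvPolynomial.smul_eq_C_mul, map_smul, hLX, smul_eq_mul]
  have hite : ∀ s t : Fin n, (if s = t then 1 else 0 : EntryPoly n q) =
      MvPolynomial.C (if s = t then 1 else 0) := fun s t => by split_ifs <;> simp
  have hI2 : ∀ p ∈ P.I2, L p = 0 := by
    intro p hp
    refine P.map_eq_zero_of_mem_I2 L ?_ ?_ ?_ ?_ ?_ ?_ ?_ hp
    · intro s t
      rw [f1_apply, hite, map_sub, map_sum, hLC]
      simp only [hLX]
      rw [← Matrix.sum_apply, hsum, Matrix.one_apply, sub_self]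
    · rintro ⟨i, a⟩ s t
      induction a with | _ u v
      have := congrFun (congrFun (congrArg Subtype.val (hW1 i s t)) u) v
      simp only [Submodule.coe_sum, Matrix.sum_apply, Submodule.coe_smul, Matrix.smul_apply,
        smul_eq_mul] at this
      rw [f1_apply, hite, mul_sub, Finset.mul_sum, map_sub, map_sum, hLXC, ← this]
      simp only [← traceVar_symUnit _ s t, hLXY, sub_self]
    · intro i
      rw [f2_eq, map_sub, map_sum, hLC, ← htr]
      simp only [hLX, Matrix.trace, Matrix.diag_apply, sub_self]
    · rintro ⟨i, a⟩ j
      induction a with | _ u v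
      have := congrFun (congrFun (congrArg Subtype.val (hW2 i j)) u) v
      simp only [Submodule.coe_sum, Matrix.sum_apply, Submodule.coe_smul, Matrix.smul_apply,
        smul_eq_mul] at this
      rw [f2_eq, mul_sub, Finset.mul_sum, map_sub, map_sum, hLXC, ← this]
      simp only [← traceVar_symUnit j, hLXY, sub_self]
    · intro i s t
      rw [f3_apply, map_sub, map_sum, hLX, ← hW3]
      simp only [← traceVar_symUnit i, hLW, sub_self]
    · intro k
      rw [f4_eq, map_sub, map_sum, hLC, ← hlin]
      simp only [map_smul, hLZ, smul_eq_mul, Matrix.trace_mul_comm (P.coeff k).1, sub_self]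
    · rintro ⟨i, a⟩ k
      induction a with | _ u v
      have := congrFun (congrFun (congrArg Subtype.val (hW4 i k)) u) v
      simp only [Submodule.coe_sum, Matrix.sum_apply, Submodule.coe_smul, Matrix.smul_apply,
        smul_eq_mul] at this
      rw [f4_eq, mul_sub, Finset.mul_sum, map_sub, map_sum, hLXC, ← this]
      simp only [mul_smul_comm, map_smul, hLXY, smul_eq_mul, sub_self]
  rintro ⟨p, hp, σ, hσ, hpσ⟩
  have h := congrArg L hpσ
  simp only [map_add, map_neg, hL1, hI2 p hp] at h
  linarith [hLsq σ hσ]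

end AffineIEP

/-! ### A point of the relaxation from a separating functional -/

namespace AffineIEP

variable {n q ℓ : ℕ}

open MvPolynomial

/-- The convex cone `I2 + Σ`. -/
def truncatedCone (P : AffineIEP n q ℓ) : PointedCone ℝ (EntryPoly n q) where
  carrier := P.I2 + sumsOfSquares n q
  zero_mem' := ⟨0, P.I2Submodule.zero_mem, 0, IsSumSq.zero, add_zero 0⟩
  add_mem' := by
    rintro _ _ ⟨p, hp, σ, hσ, rfl⟩ ⟨p', hp', σ', hσ', rfl⟩
    exact ⟨p + p', P.I2Submodule.add_mem hp hp', σ + σ', IsSumSq.add hσ hσ',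
      add_add_add_comm _ _ _ _⟩
  smul_mem' := by
    rintro ⟨c, hc⟩ _ ⟨p, hp, σ, hσ, rfl⟩
    exact ⟨c • p, P.I2Submodule.smul_mem c hp, c • σ, IsSumSq.smul_mvPolynomial hc hσ,
      (smul_add _ _ _).symm⟩

theorem mem_truncatedCone_of_mem_I2 {P : AffineIEP n q ℓ} {p : EntryPoly n q}
    (hp : p ∈ P.I2Submodule) : p ∈ P.truncatedCone :=
  ⟨p, hp, 0, IsSumSq.zero, add_zero p⟩

theorem mem_truncatedCone_of_isSumSq (P : AffineIEP n q ℓ) {p : EntryPoly n q} (hp : IsSumSq p) :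
    p ∈ P.truncatedCone :=
  ⟨0, P.I2Submodule.zero_mem, p, hp, zero_add p⟩

/-- The squares of the variables are bounded in the order of the cone: modulo `I2`, the sum of the
squares of all entries of `Z_i` is `Tr Z_i² = Tr Z_i = m_i`. -/
theorem mult_sub_X_sq_mem (P : AffineIEP n q ℓ) (a : Fin q × Sym2 (Fin n)) :
    (P.mult a.1 : ℝ) • (1 : EntryPoly n q) - X a * X a ∈ P.truncatedCone := by
  obtain ⟨i, a⟩ := a
  induction a with | _ u v
  let g : Fin n × Fin n → EntryPoly n q := fun st => X (i, s(st.1, st.2))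
  have htr : ∑ s, P.f3 i s s = ∑ st, g st * g st - ∑ s, X (i, s(s, s)) := by
    simp only [f3_apply, Finset.sum_sub_distrib, Fintype.sum_prod_type, g]
  have hI : -(∑ s, P.f3 i s s) - 1 * P.f2 i ∈ P.I2Submodule :=
    sub_mem (neg_mem (sum_mem fun s _ => P.f3_mem i s s)) (P.mul_f2_mem (by simp) i)
  have hS : IsSumSq (∑ st ∈ Finset.univ.erase (u, v), g st * g st) := IsSumSq.sum_mul_self _ _
  refine ⟨_, hI, _, hS, ?_⟩
  have := Finset.add_sum_erase Finset.univ (fun st => g st * g st) (Finset.mem_univ (u, v))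
  have hm : (P.mult i : ℝ) • (1 : EntryPoly n q) = C (P.mult i : ℝ) := by
    rw [smul_eq_C_mul, mul_one]
  change _ + _ = (P.mult i : ℝ) • (1 : EntryPoly n q) - g (u, v) * g (u, v)
  rw [htr, f2_eq, hm]
  linear_combination this

theorem exists_smul_one_sub_sq_mem (P : AffineIEP n q ℓ) {p : EntryPoly n q}
    (hp : p ∈ Submodule.span ℝ (Set.range X)) :
    ∃ N : ℝ, N • (1 : EntryPoly n q) - p * p ∈ P.truncatedCone := by
  have hsmul : ∀ {c : ℝ} {x : EntryPoly n q}, 0 ≤ c → x ∈ P.truncatedCone →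
      c • x ∈ P.truncatedCone := fun hc hx => P.truncatedCone.smul_mem hc hx
  induction hp using Submodule.span_induction with
  | mem x hx =>
    obtain ⟨a, rfl⟩ := hx
    exact ⟨_, P.mult_sub_X_sq_mem a⟩
  | zero => exact ⟨0, by simp⟩
  | add x y _ _ hx hy =>
    obtain ⟨N, hN⟩ := hx
    obtain ⟨M, hM⟩ := hy
    refine ⟨2 * (N + M), ?_⟩
    have h := P.truncatedCone.add_mem (hsmul zero_le_two (P.truncatedCone.add_mem hN hM))
      (P.mem_truncatedCone_of_isSumSq (.mul_self (x - y)))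
    convert h using 1
    simp only [smul_eq_C_mul, map_mul, map_add, map_ofNat]
    ring
  | smul c x _ hx =>
    obtain ⟨N, hN⟩ := hx
    refine ⟨c * c * N, ?_⟩
    convert hsmul (mul_self_nonneg c) hN using 1
    simp only [smul_eq_C_mul, map_mul]
    ring

theorem traceVar_mem_span (i : Fin q) (Y : SymMat n) :
    (traceVar i Y : EntryPoly n q) ∈ Submodule.span ℝ (Set.range X) :=
  traceVar_apply i Y ▸ sum_mem fun _ _ => sum_mem fun _ _ =>
    Submodule.smul_mem _ _ (Submodule.subset_span (Set.mem_range_self _))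

/-- The symmetric matrix `L (g • Z_i)`, with entries `L ((Z_i)_{s,t} g)`, as a linear map in the
polynomial `g`. For `g = 1` it is the matrix of first moments of `Z_i`. -/
noncomputable def functionalMat (L : EntryPoly n q →ₗ[ℝ] ℝ) (i : Fin q) :
    EntryPoly n q →ₗ[ℝ] SymMat n where
  toFun g := ⟨Matrix.of fun s t => L (X (i, s(s, t)) * g), by
    change Matrix.IsSymm _
    ext s t
    simp [Sym2.eq_swap]⟩
  map_add' g g' := by
    apply Subtype.ext
    ext s t
    simp [mul_add]
  map_smul' c g := by
    apply Subtype.ext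
    ext s t
    simp

theorem functionalMat_apply (L : EntryPoly n q →ₗ[ℝ] ℝ) (i : Fin q) (g : EntryPoly n q)
    (s t : Fin n) : (functionalMat L i g : Matrix (Fin n) (Fin n) ℝ) s t =
      L (X (i, s(s, t)) * g) := rfl

theorem trace_mul_functionalMat (L : EntryPoly n q →ₗ[ℝ] ℝ) (i : Fin q) (A : SymMat n)
    (g : EntryPoly n q) :
    ((A : Matrix (Fin n) (Fin n) ℝ) * (functionalMat L i g : Matrix (Fin n) (Fin n) ℝ)).trace =
      L (traceVar i A * g) := by
  simp only [Matrix.trace, Matrix.diag_apply, Matrix.mul_apply, traceVar_apply, Finset.sum_mul,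
    map_sum, smul_mul_assoc, map_smul, smul_eq_mul]
  refine Finset.sum_congr rfl fun s _ => Finset.sum_congr rfl fun t _ => ?_
  rw [functionalMat_apply, Sym2.eq_swap]

/-- The moments `Z_i = L (Z_i)` and `W_{i,j} (Y) = L (Tr (Z_j Y) • Z_i)` of a functional `L` that
vanishes on `I2` and is nonnegative on squares of linear forms give a point of `R2`. -/
theorem R2_nonempty_of_functional (P : AffineIEP n q ℓ) (L : EntryPoly n q →ₗ[ℝ] ℝ)
    (hL1 : L 1 = 1) (hI2 : ∀ p ∈ P.I2Submodule, L p = 0)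
    (hsq : ∀ p ∈ Submodule.span ℝ (Set.range X), 0 ≤ L (p * p)) : P.R2.Nonempty := by
  have hX : ∀ a : Fin q × Sym2 (Fin n), (X a : EntryPoly n q).totalDegree ≤ 1 :=
    fun a => (totalDegree_X a).le
  have hd1 : (1 : EntryPoly n q).totalDegree ≤ 1 := by simp
  have hLC : ∀ (c : ℝ) (g : EntryPoly n q), L (g * C c) = c * L g := fun c g => by
    rw [mul_comm, ← smul_eq_C_mul, map_smul, smul_eq_mul]
  have hite : ∀ s t : Fin n, (if s = t then 1 else 0 : EntryPoly n q) =
      C (if s = t then 1 else 0) := fun s t => by split_ifs <;> simp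
  let W : Fin q → Fin q → SymMat n →ₗ[ℝ] SymMat n := fun i j =>
    (functionalMat L i).comp (traceVar j)
  let T : (Fin q → SymMat n) →ₗ[ℝ] (Fin q → SymMat n) :=
    LinearMap.pi fun i => ∑ j, (W i j).comp (LinearMap.proj j)
  have hT : ∀ A i, T A i = ∑ j, W i j (A j) := fun A i => by simp [T]
  have hTL : ∀ A B, traceInner A (T B) =
      L ((∑ i, traceVar i (A i)) * ∑ j, traceVar j (B j)) := by
    intro A B
    simp only [traceInner, hT, W, LinearMap.comp_apply, ← map_sum, trace_mul_functionalMat]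
    rw [Finset.sum_mul]
  have hf1 : ∀ (g : EntryPoly n q), g.totalDegree ≤ 1 → ∀ s t,
      ∑ j, L (g * X (j, s(s, t))) = (if s = t then 1 else 0) * L g := by
    intro g hg s t
    have h := hI2 _ (P.mul_f1_mem hg s t)
    rw [f1_apply, hite, mul_sub, map_sub, hLC, Finset.mul_sum, map_sum] at h
    exact sub_eq_zero.1 h
  have hf2 : ∀ (g : EntryPoly n q), g.totalDegree ≤ 1 → ∀ j,
      ∑ s, L (g * X (j, s(s, s))) = P.mult j * L g := by
    intro g hg j
    have h := hI2 _ (P.mul_f2_mem hg j)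
    rw [f2_eq, mul_sub, map_sub, hLC, Finset.mul_sum, map_sum] at h
    exact sub_eq_zero.1 h
  have hf3 : ∀ i s t, ∑ r, L (X (i, s(s, r)) * X (i, s(t, r))) = L (X (i, s(s, t))) := by
    intro i s t
    have h := hI2 _ (P.f3_mem i s t)
    rw [f3_apply, map_sub, map_sum] at h
    exact sub_eq_zero.1 h
  have hf4 : ∀ (g : EntryPoly n q), g.totalDegree ≤ 1 → ∀ k,
      ∑ j, P.eig j * L (g * traceVar j (P.coeff k)) = P.rhs k * L g := by
    intro g hg k
    have h := hI2 _ (P.mul_f4_mem hg k)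
    rw [f4_eq, mul_sub, map_sub, hLC, Finset.mul_sum, map_sum] at h
    simpa only [mul_smul_comm, map_smul, smul_eq_mul] using sub_eq_zero.1 h
  refine ⟨fun i => functionalMat L i 1, W, T, ⟨?_, ?_⟩, hT, ?_, ?_, ?_, ?_, ?_, ?_, ?_, ?_⟩
  · intro A B
    rw [traceInner_comm, hTL, hTL, mul_comm]
  · intro A
    rw [hTL]
    exact hsq _ (sum_mem fun i _ => traceVar_mem_span i _)
  · intro i
    refine Matrix.PosSemidef.of_dotProduct_mulVec_nonneg ?_ fun x => ?_
    · rw [Matrix.IsHermitian, Matrix.conjTranspose_eq_transpose_of_trivial]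
      exact (functionalMat L i 1).2
    · -- `xᵀ L(Z_i) x = L (xᵀ Z_i² x)`, and `xᵀ Z_i² x` is a sum of squares of linear forms
      have hnn : 0 ≤ ∑ r, L ((∑ s, x s • X (i, s(s, r))) * ∑ s, x s • X (i, s(s, r))) :=
        Finset.sum_nonneg fun r _ => hsq _ (sum_mem fun s _ =>
          Submodule.smul_mem _ _ (Submodule.subset_span (Set.mem_range_self _)))
      have hexp : ∀ r, L ((∑ s, x s • X (i, s(s, r))) * ∑ s, x s • X (i, s(s, r))) =
          ∑ s, ∑ t, x s * x t * L (X (i, s(s, r)) * X (i, s(t, r))) := by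
        intro r
        rw [Finset.sum_mul_sum]
        simp only [map_sum, smul_mul_smul_comm, map_smul, smul_eq_mul]
      refine hnn.trans_eq ?_
      simp only [hexp]
      simp only [dotProduct, Matrix.mulVec, star_trivial, functionalMat_apply, mul_one, ← hf3,
        Finset.mul_sum, Finset.sum_mul]
      rw [Finset.sum_comm]
      refine Finset.sum_congr rfl fun s _ => ?_
      rw [Finset.sum_comm]
      refine Finset.sum_congr rfl fun t _ => Finset.sum_congr rfl fun r _ => ?_
      ring
  · ext s t
    have := hf1 1 hd1 s t
    simpa [Matrix.sum_apply, functionalMat_apply, hL1, Matrix.one_apply] using this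
  · intro i
    have := hf2 1 hd1 i
    simpa [Matrix.trace, functionalMat_apply, hL1] using this
  · intro k
    have := hf4 1 hd1 k
    simpa [Matrix.trace_mul_comm (functionalMat L _ 1).1, trace_mul_functionalMat, hL1] using this
  · intro i s t
    apply Subtype.ext
    ext u v
    simp only [Submodule.coe_sum, Matrix.sum_apply, W, LinearMap.comp_apply, functionalMat_apply,
      Submodule.coe_smul, Matrix.smul_apply, smul_eq_mul, traceVar_symUnit, mul_one]
    exact hf1 _ (hX _) s t
  · intro i j
    apply Subtype.ext
    ext u v
    simp only [Submodule.coe_sum, Matrix.sum_apply, W, LinearMap.comp_apply, functionalMat_apply,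
      Submodule.coe_smul, Matrix.smul_apply, smul_eq_mul, traceVar_symUnit, mul_one]
    exact hf2 _ (hX _) j
  · intro i s t
    simp only [W, LinearMap.comp_apply, trace_mul_functionalMat, traceVar_symUnit,
      functionalMat_apply, mul_one]
    exact hf3 i s t
  · intro i k
    apply Subtype.ext
    ext u v
    simp only [Submodule.coe_sum, Matrix.sum_apply, W, LinearMap.comp_apply, functionalMat_apply,
      Submodule.coe_smul, Matrix.smul_apply, smul_eq_mul, mul_one]
    exact hf4 _ (hX _) k

theorem R2_nonempty_of_neg_one_notMem (P : AffineIEP n q ℓ)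
    (h : (-1 : EntryPoly n q) ∉ P.I2 + sumsOfSquares n q) : P.R2.Nonempty := by
  obtain ⟨L, hL1, hL⟩ := exists_linear_functional_of_order_unit P.truncatedCone 1
    (P.mem_truncatedCone_of_isSumSq .one) h
  refine P.R2_nonempty_of_functional L hL1 (fun p hp => ?_) fun p hp => ?_
  · have hnn : ∀ p ∈ P.I2Submodule, 0 ≤ L p := fun p hp =>
      hL p (mem_truncatedCone_of_mem_I2 hp)
        ⟨0, by simpa using mem_truncatedCone_of_mem_I2 (neg_mem hp)⟩
    have := hnn _ (neg_mem hp)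
    rw [map_neg] at this
    exact le_antisymm (by linarith) (hnn p hp)
  · exact hL _ (P.mem_truncatedCone_of_isSumSq (.mul_self p)) (P.exists_smul_one_sub_sq_mem hp)

end AffineIEP

theorem proposition3 {n q ℓ : ℕ} (P : AffineIEP n q ℓ) :
    Xor P.R2.Nonempty ((-1 : EntryPoly n q) ∈ P.I2 + AffineIEP.sumsOfSquares n q) := by
  by_cases h : (-1 : EntryPoly n q) ∈ P.I2 + AffineIEP.sumsOfSquares n q
  · exact Or.inr ⟨h, fun hR => P.neg_one_notMem_of_R2_nonempty hR h⟩
  · exact Or.inl ⟨P.R2_nonempty_of_neg_one_notMem h, h⟩
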